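/- Conventions. Let $P$ be a nonempty set of propositional letters, $p\in P$. Formulas are built from letters of $P$ by $\top,\bot,\wedge,\vee,\Box,\Diamond$; a consequence pair is an expression $\phi\trianglelefteq\psi$ with $\phi,\psi$ formulas. For a set $\Delta$ of consequence pairs, $\mathcal L(\Delta)$ is the smallest set of consequence pairs that contains $\Delta$, is closed under uniform substitution, and is closed under the following axioms and rules (for all formulas $\alpha,\beta,\gamma$): $\alpha\trianglelefteq\top$; $\bot\trianglelefteq \alpha$; $\alpha\trianglelefteq \alpha$; from $\alpha\trianglelefteq \beta$ and $\beta\trianglelefteq \gamma$ infer $\alpha\trianglelefteq \gamma$; $\alpha\wedge \beta\trianglelefteq \alpha$; $\alpha\wedge \beta\trianglelefteq \beta$; $\alpha\trianglelefteq \alpha\vee \beta$; $\beta\trianglelefteq \alpha\vee \beta$; from $\alpha\trianglelefteq \beta$ and $\alpha\trianglelefteq \gamma$ infer $\alpha\trianglelefteq \beta\wedge \gamma$; from $\alpha\trianglelefteq \gamma$ and $\beta\trianglelefteq \gamma$ infer $\alpha\vee \beta\trianglelefteq \gamma$; $\top\trianglelefteq\Box\top$; $\top\trianglelefteq\Diamond\top$;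 from $\alpha\trianglelefteq \beta$ infer $\Box \alpha\trianglelefteq\Box \beta$ and $\Diamond \alpha\trianglelefteq\Diamond \beta$; $\Box \alpha\wedge\Box \beta\trianglelefteq\Box(\alpha\wedge \beta)$; $\Diamond \alpha\wedge\Box \beta\trianglelefteq\Diamond(\alpha\wedge \beta)$. A modal lattice is a bounded lattice $A$ with operations $\Box,\Diamond$ satisfying $\Box\top=\top$, $\Diamond\top=\top$, $\Box a\wedge\Box b=\Box(a\wedge b)$, $\Diamond a\vee\Diamond b\le\Diamond(a\vee b)$, $\Diamond a\wedge\Box b\le\Diamond(a\wedge b)$. $\mathsf K(\Delta)$ is the class of modal lattices $A$ such that $\sigma(\phi)\le\sigma(\psi)$ for every $\phi\trianglelefteq\psi$ in $\Delta$ and every homomorphism $\sigma$ from formulas to $A$. An L-frame is a meet semilattice $(X,1,\curlywedge)$ with top element $1$ and order $\preceq$. Filters are nonempty up-sets closed under binary meets (the improper filter is allowed). A modal L-frame is an L-frame with a binary relation $R$ such that: (i) if $x\preceq y$ and $yRz$, there is $w$ with $xRw$ and $w\preceq z$; (ii) if $x\preceq y$ and $xRw$, there is $z$ with $yRz$ and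 $w\preceq z$; (iii) if $(x\curlywedge y)Rz$, there are $u,v$ with $xRu$, $yRv$ and $u\curlywedge v\preceq z$; (iv) if $xRu$ and $yRv$ then $(x\curlywedge y)R(u\curlywedge v)$; (v) $1Rx$ iff $x=1$. A valuation $V$ assigns a filter $V(q)$ of $X$ to each letter $q$, and truth at $x\in X$ is defined by: $x\Vdash q$ iff $x\in V(q)$; $x\Vdash\top$ always; $x\Vdash\bot$ iff $x=1$; $x\Vdash\phi\wedge\psi$ iff $x\Vdash\phi$ and $x\Vdash\psi$; $x\Vdash\phi\vee\psi$ iff there are $y\Vdash\phi$ and $z\Vdash\psi$ with $y\curlywedge z\preceq x$; $x\Vdash\Box\phi$ iff $y\Vdash\phi$ for all $y$ with $xRy$; $x\Vdash\Diamond\phi$ iff $y\Vdash\phi$ for some $y$ with $xRy$. The frame validates $\phi\trianglelefteq\psi$ if, under every valuation, $\psi$ is true at every point at which $\phi$ is true. $\mathcal L(\Delta)$ is sound and complete with respect to a class $\mathsf C$ of modal L-frames if for all formulas $\phi,\psi$ over $P$: $\phi\trianglelefteq\psi$ is validated by all members of $\mathsf C$ iff it belongs to $\mathcal L(\Delta)$.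 An L-space is an L-frame with a compact topology such that whenever $x\not\preceq y$ some clopen filter contains $x$ but not $y$, such that $\{1\}$ is clopen, and such that for clopen filters $U,V$ the filter $\{x\mid \exists y\in U,\ z\in V:\ y\curlywedge z\preceq x\}$ is clopen. For a relation $R$ put $R[x]=\{y\mid xRy\}$, $\Box_RU=\{x\mid R[x]\subseteq U\}$ and $\Diamond_RU=\{x\mid R[x]\cap U\ne\emptyset\}$. A modal L-space is an L-space with a binary relation $R$ such that every $R[x]$ is nonempty; $1Rx$ iff $x=1$; $\Box_RU$ and $\Diamond_RU$ are clopen filters whenever $U$ is; and $xRy$ iff for all clopen filters $U$, $x\in\Box_RU$ implies $y\in U$ and $y\in U$ implies $x\in\Diamond_RU$. A morphism of modal L-spaces is a continuous map $f$ that preserves $1$, $\curlywedge$ and $R$ and satisfies: $f(x)=1$ implies $x=1$; if $y'\curlywedge z'\preceq f(x)$, there are $y,z$ with $y'\preceq f(y)$, $z'\preceq f(z)$ and $y\curlywedge z\preceq x$; if $f(x)Rz$, there are $y,y'$ with $xRy$, $xRy'$ and $f(y)\preceq z\preceq f(y')$. Isomorphisms are mutually inverse pairs of such morphisms. The dual $\mathsf{Fil_L}(A)$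 of a modal lattice $A$ is the set of filters of $A$ (including $A$), ordered by inclusion, with meet given by intersection and top element $A$, with the topology generated by the sets $\{F\mid a\in F\}$ $(a\in A)$ and their complements, and with the relation $F R G$ iff for all $a\in A$, $\Box a\in F$ implies $a\in G$ and $a\in G$ implies $\Diamond a\in F$. Consider the axioms $\mathsf T$: $\Box p\trianglelefteq p$, $p\trianglelefteq\Diamond p$; $\mathsf 4$: $\Box p\trianglelefteq\Box\Box p$, $\Diamond\Diamond p\trianglelefteq\Diamond p$; $\mathsf B$: $p\trianglelefteq\Box\Diamond p$, $\Diamond\Box p\trianglelefteq p$; $\mathsf 5$: $\Diamond p\trianglelefteq\Box\Diamond p$, $\Diamond\Box p\trianglelefteq\Box p$; $\mathsf{.2}$: $\Diamond\Box p\trianglelefteq\Box\Diamond p$. To them correspond, respectively, reflexivity ($xRx$), transitivity ($xRy$, $yRz$ imply $xRz$), symmetry ($xRy$ implies $yRx$), Euclideanity ($xRy$, $xRz$ imply $yRz$) and directedness ($xRy$, $xRz$ imply that there is $t$ with $yRt$ and $zRt$). Theorem. Let $\Gamma\subseteq\{\mathsf T,\mathsf 4,\mathsf B,\mathsf 5,\mathsf{.2}\}$,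 and let $\Theta_\Gamma$ be the set of relational properties corresponding to the axioms in $\Gamma$. (1) The class of modal L-spaces satisfying $\Theta_\Gamma$ is exactly, up to isomorphism of modal L-spaces, the class of the duals $\mathsf{Fil_L}(A)$ with $A\in\mathsf K(\Gamma)$: a semilattice with top, topology and binary relation is a modal L-space satisfying $\Theta_\Gamma$ if and only if it is isomorphic to $\mathsf{Fil_L}(A)$ for some $A\in\mathsf K(\Gamma)$. (2) The logic $\mathcal L(\Gamma)$ is sound and complete with respect to the class of modal L-frames satisfying $\Theta_\Gamma$. -/

import Mathlib

universe u v w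

namespace WPML

/-! ### Syntax and proof theory -/

/-- Formulas of the language of modal lattices over the propositional letters `P`. -/
inductive Form (P : Type u) : Type u
  | var : P → Form P
  | top : Form P
  | bot : Form P
  | and : Form P → Form P → Form P
  | or : Form P → Form P → Form P
  | box : Form P → Form P
  | dia : Form P → Form P

/-- Uniform substitution. -/
def Form.subst {P : Type u} (σ : P → Form P) : Form P → Form P
  | .var p => σ p
  | .top => .top
  | .bot => .bot
  | .and φ ψ => .and (φ.subst σ) (ψ.subst σ)
  | .or φ ψ => .or (φ.subst σ) (ψ.subst σ)
  | .box φ => .box (φ.subst σ)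
  | .dia φ => .dia (φ.subst σ)

/-- A consequence pair `lhs ⊴ rhs`. -/
structure ConsequencePair (P : Type u) : Type u where
  lhs : Form P
  rhs : Form P

/-- `Derives Γ φ ψ` says that `φ ⊴ ψ` belongs to the logic `L(Γ)`: the least set of consequence
pairs that contains `Γ` and is closed under uniform substitution and under the axioms and rules of
weak positive modal logic. -/
inductive Derives {P : Type u} (Γ : Set (ConsequencePair P)) : Form P → Form P → Prop
  | ax {c : ConsequencePair P} : c ∈ Γ → Derives Γ c.lhs c.rhs
  | subst (σ : P → Form P) {φ ψ : Form P} :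
      Derives Γ φ ψ → Derives Γ (φ.subst σ) (ψ.subst σ)
  | top (φ : Form P) : Derives Γ φ .top
  | bot (φ : Form P) : Derives Γ .bot φ
  | refl (φ : Form P) : Derives Γ φ φ
  | trans {φ ψ χ : Form P} : Derives Γ φ ψ → Derives Γ ψ χ → Derives Γ φ χ
  | and_left (φ ψ : Form P) : Derives Γ (.and φ ψ) φ
  | and_right (φ ψ : Form P) : Derives Γ (.and φ ψ) ψ
  | or_left (φ ψ : Form P) : Derives Γ φ (.or φ ψ)
  | or_right (φ ψ : Form P) : Derives Γ ψ (.or φ ψ)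
  | and_intro {φ ψ χ : Form P} : Derives Γ φ ψ → Derives Γ φ χ → Derives Γ φ (.and ψ χ)
  | or_elim {φ ψ χ : Form P} : Derives Γ φ χ → Derives Γ ψ χ → Derives Γ (.or φ ψ) χ
  | box_top : Derives Γ .top (.box .top)
  | dia_top : Derives Γ .top (.dia .top)
  | box_mono {φ ψ : Form P} : Derives Γ φ ψ → Derives Γ (.box φ) (.box ψ)
  | dia_mono {φ ψ : Form P} : Derives Γ φ ψ → Derives Γ (.dia φ) (.dia ψ)
  | linearity (φ ψ : Form P) : Derives Γ (.and (.box φ) (.box ψ)) (.box (.and φ ψ))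
  | duality (φ ψ : Form P) : Derives Γ (.and (.dia φ) (.box ψ)) (.dia (.and φ ψ))

/-! ### Algebraic semantics -/

/-- Modal lattices. -/
class ModalLattice (A : Type w) extends Lattice A, BoundedOrder A where
  box : A → A
  dia : A → A
  box_top : box ⊤ = ⊤
  dia_top : dia ⊤ = ⊤
  box_inf_box : ∀ a b : A, box a ⊓ box b = box (a ⊓ b)
  dia_sup_dia_le : ∀ a b : A, dia a ⊔ dia b ≤ dia (a ⊔ b)
  dia_inf_box_le : ∀ a b : A, dia a ⊓ box b ≤ dia (a ⊓ b)

/-- The homomorphism from the formula algebra to `A` that extends `σ : P → A`. -/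
def Form.eval {P : Type u} {A : Type w} [ModalLattice A] (σ : P → A) : Form P → A
  | .var p => σ p
  | .top => ⊤
  | .bot => ⊥
  | .and φ ψ => φ.eval σ ⊓ ψ.eval σ
  | .or φ ψ => φ.eval σ ⊔ ψ.eval σ
  | .box φ => ModalLattice.box (φ.eval σ)
  | .dia φ => ModalLattice.dia (φ.eval σ)

/-- `A` belongs to the variety `K(Γ)`: it validates every consequence pair in `Γ`. -/
def InVariety {P : Type u} (Γ : Set (ConsequencePair P)) (A : Type w) [ModalLattice A] : Prop :=
  ∀ c ∈ Γ, ∀ σ : P → A, c.lhs.eval σ ≤ c.rhs.eval σ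

/-! ### Modal L-frames -/

/-- The conditions on a relation `R` that turn an L-frame, that is, a meet semilattice with a top
element `1 = ⊤`, into a modal L-frame. -/
structure IsModalLFrame {X : Type v} [SemilatticeInf X] [OrderTop X] (R : X → X → Prop) :
    Prop where
  back_le : ∀ x y z, x ≤ y → R y z → ∃ w, R x w ∧ w ≤ z
  forth_le : ∀ x y w, x ≤ y → R x w → ∃ z, R y z ∧ w ≤ z
  of_inf : ∀ x y z, R (x ⊓ y) z → ∃ u v, R x u ∧ R y v ∧ u ⊓ v ≤ z
  inf : ∀ x y u v, R x u → R y v → R (x ⊓ y) (u ⊓ v)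
  top_iff : ∀ x, R ⊤ x ↔ x = ⊤

/-- Modal L-frames. -/
structure ModalLFrame : Type (v + 1) where
  carrier : Type v
  [semilatticeInf : SemilatticeInf carrier]
  [orderTop : OrderTop carrier]
  rel : carrier → carrier → Prop
  isModalLFrame : IsModalLFrame rel

attribute [instance] ModalLFrame.semilatticeInf ModalLFrame.orderTop

/-- Truth at the state `x` of the model with relation `R` and valuation `V`. -/
def Forces {P : Type u} {X : Type v} [SemilatticeInf X] [OrderTop X] (R : X → X → Prop)
    (V : P → Order.PFilter X) : X → Form P → Prop
  | x, .var p => x ∈ V p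
  | _, .top => True
  | x, .bot => x = ⊤
  | x, .and φ ψ => Forces R V x φ ∧ Forces R V x ψ
  | x, .or φ ψ => ∃ y z, Forces R V y φ ∧ Forces R V z ψ ∧ y ⊓ z ≤ x
  | x, .box φ => ∀ y, R x y → Forces R V y φ
  | x, .dia φ => ∃ y, R x y ∧ Forces R V y φ

/-- The modal L-frame `F` validates `φ ⊴ ψ`. -/
def ModalLFrame.Validates {P : Type u} (F : ModalLFrame.{v}) (φ ψ : Form P) : Prop :=
  ∀ (V : P → Order.PFilter F.carrier) (x : F.carrier), Forces F.rel V x φ → Forces F.rel V x ψ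

/-- The logic `L(Γ)` is sound and complete with respect to the class `C` of modal L-frames. -/
def SoundAndComplete {P : Type u} (Γ : Set (ConsequencePair P)) (C : Set ModalLFrame.{v}) :
    Prop :=
  ∀ φ ψ : Form P, (∀ F ∈ C, F.Validates φ ψ) ↔ Derives Γ φ ψ

/-! ### Modal L-spaces -/

/-- HMS-spaces. -/
structure IsHMSSpace (X : Type w) [SemilatticeInf X] [OrderTop X] [TopologicalSpace X] :
    Prop where
  compact : CompactSpace X
  separation : ∀ x y : X, ¬ x ≤ y → ∃ U : Order.PFilter X, IsClopen (U : Set X) ∧ x ∈ U ∧ y ∉ U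

/-- The filter generated by the union of the filters `U` and `V`. -/
def filterJoin {X : Type w} [SemilatticeInf X] (U V : Set X) : Set X :=
  {x | ∃ y ∈ U, ∃ z ∈ V, y ⊓ z ≤ x}

/-- L-spaces. -/
structure IsLSpace (X : Type w) [SemilatticeInf X] [OrderTop X] [TopologicalSpace X] : Prop
    extends IsHMSSpace X where
  isClopen_top : IsClopen ({⊤} : Set X)
  isClopen_join : ∀ U V : Order.PFilter X, IsClopen (U : Set X) → IsClopen (V : Set X) →
    IsClopen (filterJoin (U : Set X) (V : Set X))

/-- `□_R U`. -/
def boxR {X : Type w} (R : X → X → Prop) (U : Set X) : Set X := {x | ∀ y, R x y → y ∈ U}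

/-- `◇_R U`. -/
def diaR {X : Type w} (R : X → X → Prop) (U : Set X) : Set X := {x | ∃ y, R x y ∧ y ∈ U}

/-- `X` with the relation `R` is a modal L-space. The clause `serial` says that every `R[x]` is
nonempty; it is part of `(X, R)` being a modal L-frame, as the relation of a modal L-space is. -/
structure IsModalLSpace {X : Type w} [SemilatticeInf X] [OrderTop X] [TopologicalSpace X]
    (R : X → X → Prop) : Prop where
  isLSpace : IsLSpace X
  serial : ∀ x, ∃ y, R x y
  top_iff : ∀ x, R ⊤ x ↔ x = ⊤
  box_clopen : ∀ U : Order.PFilter X, IsClopen (U : Set X) →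
    Order.IsPFilter (boxR R (U : Set X)) ∧ IsClopen (boxR R (U : Set X))
  dia_clopen : ∀ U : Order.PFilter X, IsClopen (U : Set X) →
    Order.IsPFilter (diaR R (U : Set X)) ∧ IsClopen (diaR R (U : Set X))
  rel_iff : ∀ x y, R x y ↔ ∀ U : Order.PFilter X, IsClopen (U : Set X) →
    (x ∈ boxR R (U : Set X) → y ∈ U) ∧ (y ∈ U → x ∈ diaR R (U : Set X))

/-- L-morphisms between L-frames. -/
structure IsLMorphism {X Y : Type w} [SemilatticeInf X] [OrderTop X] [SemilatticeInf Y]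
    [OrderTop Y] (f : X → Y) : Prop where
  map_top : f ⊤ = ⊤
  map_inf : ∀ x y, f (x ⊓ y) = f x ⊓ f y
  eq_top : ∀ x, f x = ⊤ → x = ⊤
  inf_le : ∀ (x : X) (y' z' : Y), y' ⊓ z' ≤ f x → ∃ y z, y' ≤ f y ∧ z' ≤ f z ∧ y ⊓ z ≤ x

/-- Modal L-space morphisms: continuous bounded L-morphisms. -/
structure IsModalLSpaceMorphism {X Y : Type w} [SemilatticeInf X] [OrderTop X]
    [TopologicalSpace X] [SemilatticeInf Y] [OrderTop Y] [TopologicalSpace Y]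
    (R : X → X → Prop) (S : Y → Y → Prop) (f : X → Y) : Prop extends IsLMorphism f where
  continuous : Continuous f
  map_rel : ∀ x y, R x y → S (f x) (f y)
  back_le : ∀ x z, S (f x) z → ∃ y, R x y ∧ f y ≤ z
  back_ge : ∀ x z, S (f x) z → ∃ y, R x y ∧ z ≤ f y

/-- Isomorphism of modal L-spaces. -/
def ModalLSpaceIso {X Y : Type w} [SemilatticeInf X] [OrderTop X]
    [TopologicalSpace X] [SemilatticeInf Y] [OrderTop Y] [TopologicalSpace Y]
    (R : X → X → Prop) (S : Y → Y → Prop) : Prop :=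
  ∃ (f : X → Y) (g : Y → X), IsModalLSpaceMorphism R S f ∧ IsModalLSpaceMorphism S R g ∧
    Function.LeftInverse g f ∧ Function.RightInverse g f

/-! ### The dual `Fil_L(A)` of a modal lattice `A`

Its points are the filters of `A`, including `A` itself, ordered by inclusion. -/

theorem isPFilter_inter {A : Type w} [Lattice A] [BoundedOrder A] (F G : Order.PFilter A) :
    Order.IsPFilter ((F : Set A) ∩ (G : Set A)) := by
  refine Order.IsPFilter.of_def ⟨⊤, Order.PFilter.top_mem, Order.PFilter.top_mem⟩ ?_ ?_
  · rintro a ⟨haF, haG⟩ b ⟨hbF, hbG⟩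
    exact ⟨a ⊓ b, ⟨Order.PFilter.inf_mem haF hbF, Order.PFilter.inf_mem haG hbG⟩,
      inf_le_left, inf_le_right⟩
  · rintro a b hab ⟨haF, haG⟩
    exact ⟨Order.PFilter.mem_of_le hab haF, Order.PFilter.mem_of_le hab haG⟩

/-- Meets of filters are intersections. -/
instance instSemilatticeInfPFilter {A : Type w} [Lattice A] [BoundedOrder A] :
    SemilatticeInf (Order.PFilter A) :=
  { (inferInstance : PartialOrder (Order.PFilter A)) with
    inf := fun F G => (isPFilter_inter F G).toPFilter
    inf_le_left := fun _ _ _ ha => ha.1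
    inf_le_right := fun _ _ _ ha => ha.2
    le_inf := fun _ _ _ h₁ h₂ _ ha => ⟨h₁ ha, h₂ ha⟩ }

/-- The topology generated by the sets `{F | a ∈ F}` and their complements. -/
instance instTopologicalSpacePFilter {A : Type w} [Lattice A] [BoundedOrder A] :
    TopologicalSpace (Order.PFilter A) :=
  TopologicalSpace.generateFrom
    {S | ∃ a : A, S = {F : Order.PFilter A | a ∈ F} ∨ S = {F : Order.PFilter A | a ∈ F}ᶜ}

/-- The relation on the filters of a modal lattice. -/
def dualRel (A : Type w) [ModalLattice A] (F G : Order.PFilter A) : Prop :=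
  ∀ a : A, (ModalLattice.box a ∈ F → a ∈ G) ∧ (a ∈ G → ModalLattice.dia a ∈ F)

/-! ### The axioms T, 4, B, 5, .2 and their first order conditions -/

/-- Names for the five axioms T, 4, B, 5 and .2. -/
inductive AxiomName
  | T
  | four
  | B
  | five
  | dotTwo

/-- The consequence pairs of each axiom, written with the propositional letter `p`. -/
def AxiomName.pairs {P : Type u} (p : P) : AxiomName → Set (ConsequencePair P)
  | .T => {⟨.box (.var p), .var p⟩, ⟨.var p, .dia (.var p)⟩}
  | .four => {⟨.box (.var p), .box (.box (.var p))⟩, ⟨.dia (.dia (.var p)), .dia (.var p)⟩}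
  | .B => {⟨.var p, .box (.dia (.var p))⟩, ⟨.dia (.box (.var p)), .var p⟩}
  | .five => {⟨.dia (.var p), .box (.dia (.var p))⟩, ⟨.dia (.box (.var p)), .box (.var p)⟩}
  | .dotTwo => {⟨.dia (.box (.var p)), .box (.dia (.var p))⟩}

/-- Reflexivity, transitivity, symmetry, Euclideanity and directedness. -/
def AxiomName.Condition {X : Type v} (R : X → X → Prop) : AxiomName → Prop
  | .T => ∀ x, R x x
  | .four => ∀ x y z, R x y → R y z → R x z
  | .B => ∀ x y, R x y → R y x
  | .five => ∀ x y z, R x y → R x z → R y z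
  | .dotTwo => ∀ x y z, R x y → R x z → ∃ t, R y t ∧ R z t

/-- The set of consequence pairs given by a set of axioms. -/
def axiomPairs {P : Type u} (p : P) (Γ : Set AxiomName) : Set (ConsequencePair P) :=
  ⋃ a ∈ Γ, a.pairs p

/-- `R` satisfies the conditions `Θ_Γ` that correspond to the axioms in `Γ`. -/
def Theta {X : Type v} (Γ : Set AxiomName) (R : X → X → Prop) : Prop :=
  ∀ a ∈ Γ, a.Condition R

end WPML

open WPML

/-!
In `Fil_L(A)` a formula is true at a filter `F` under the valuation `q ↦ {F | σ q ∈ F}` exactly when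
its value under `σ` belongs to `F`; conversely, a family of filters of a frame that is closed under
the connectives is a modal lattice in which formulas take their truth sets as values. Hence a frame
with the conditions `Θ_Γ` yields algebras in `K(Γ)`, and every dual of an algebra in `K(Γ)`
satisfies `Θ_Γ`: successors in the dual are built from the least successor `{a | □a ∈ F}` of `F`.
Soundness uses the algebra of all filters of a frame, and completeness the dual of a Lindenbaum
algebra.

For spaces, a closed filter of a compact ordered space in which clopen filters separate points is
principal. Thus the clopen filters of `Fil_L(A)` are the sets `{F | a ∈ F}`, which makes `Fil_L(A)`
a modal L-space, and every filter of clopen filters of a modal L-space is the set of clopen filters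
that contain some point `x`, which makes the space isomorphic to the dual of its algebra of clopen
filters.
-/

namespace WPML

open Order Set

/-! ### Modal lattices and filters -/

namespace ModalLattice

variable {A : Type w} [ModalLattice A] {a b : A}

theorem box_mono (h : a ≤ b) : box a ≤ box b := by
  rw [← inf_eq_left, box_inf_box, inf_eq_left.2 h]

theorem dia_mono (h : a ≤ b) : dia a ≤ dia b :=
  le_sup_left.trans ((dia_sup_dia_le a b).trans_eq (by rw [sup_eq_right.2 h]))

theorem box_le_dia (a : A) : box a ≤ dia a := by
  simpa only [dia_top, top_inf_eq] using dia_inf_box_le ⊤ a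

end ModalLattice

open ModalLattice

section Filters

variable {X : Type v} [SemilatticeInf X] [OrderTop X]

theorem isPFilter_iff {s : Set X} :
    IsPFilter s ↔ ⊤ ∈ s ∧ (∀ x ∈ s, ∀ y ∈ s, x ⊓ y ∈ s) ∧ IsUpperSet s := by
  refine ⟨fun hs => ⟨?_, fun x hx y hy => ?_, fun x y h hx => ?_⟩, fun ⟨htop, hinf, hup⟩ =>
    .of_def ⟨⊤, htop⟩ (fun x hx y hy => ⟨x ⊓ y, hinf x hx y hy, inf_le_left, inf_le_right⟩)
      fun h hx => hup h hx⟩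
  · exact PFilter.top_mem (F := hs.toPFilter)
  · exact PFilter.inf_mem (F := hs.toPFilter) hx hy
  · exact PFilter.mem_of_le (F := hs.toPFilter) h hx

theorem isPFilter_univ : IsPFilter (univ : Set X) :=
  isPFilter_iff.2 ⟨trivial, fun _ _ _ _ => trivial, isUpperSet_univ⟩

theorem isPFilter_singleton_top : IsPFilter ({⊤} : Set X) :=
  Ici_top (α := X) ▸ (PFilter.principal ⊤).isPFilter

theorem isPFilter_inter_of_semilatticeInf {s t : Set X} (hs : IsPFilter s) (ht : IsPFilter t) :
    IsPFilter (s ∩ t) := by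
  rw [isPFilter_iff] at *
  exact ⟨⟨hs.1, ht.1⟩, fun x hx y hy => ⟨hs.2.1 x hx.1 y hy.1, ht.2.1 x hx.2 y hy.2⟩,
    hs.2.2.inter ht.2.2⟩

theorem isPFilter_preimage {Y : Type w} [SemilatticeInf Y] [OrderTop Y] {F : Type*} [FunLike F X Y]
    [InfTopHomClass F X Y] (f : F) {s : Set Y} (hs : IsPFilter s) : IsPFilter (f ⁻¹' s) := by
  rw [isPFilter_iff] at *
  refine ⟨?_, fun x hx y hy => ?_, hs.2.2.preimage (OrderHomClass.mono f)⟩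
  · rw [mem_preimage, map_top]
    exact hs.1
  · rw [mem_preimage, map_inf]
    exact hs.2.1 _ hx _ hy

/-- The filter generated by the union of two filters, that is, `filterJoin` as a filter. -/
def pfilterJoin (F G : PFilter X) : PFilter X := ⟨F.dual ⊔ G.dual⟩

variable {F G H : PFilter X}

theorem mem_pfilterJoin {x : X} : x ∈ pfilterJoin F G ↔ ∃ y ∈ F, ∃ z ∈ G, y ⊓ z ≤ x := Iff.rfl

theorem le_pfilterJoin_left : F ≤ pfilterJoin F G := (le_sup_left : F.dual ≤ F.dual ⊔ G.dual)

theorem le_pfilterJoin_right : G ≤ pfilterJoin F G := (le_sup_right : G.dual ≤ F.dual ⊔ G.dual)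

theorem pfilterJoin_le (hF : F ≤ H) (hG : G ≤ H) : pfilterJoin F G ≤ H :=
  (sup_le hF hG : F.dual ⊔ G.dual ≤ H.dual)

theorem pfilterJoin_comm : pfilterJoin F G = pfilterJoin G F :=
  congrArg PFilter.mk (sup_comm F.dual G.dual)

end Filters

/-! ### General frames and their algebras -/

section GeneralFrames

variable {P : Type u} {X : Type v} [SemilatticeInf X] [OrderTop X] {R : X → X → Prop}

/-- `(X, R, 𝒰)` is a general frame: `𝒰` is a family of filters of `X` that is closed under the
interpretations of the connectives. All filters of a modal L-frame and the clopen filters of a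
modal L-space are the two families of interest. -/
structure IsGeneralLFrame (R : X → X → Prop) (𝒰 : Set (Set X)) : Prop where
  serial : ∀ x, ∃ y, R x y
  isPFilter : ∀ s ∈ 𝒰, IsPFilter s
  univ_mem : univ ∈ 𝒰
  singleton_top_mem : {⊤} ∈ 𝒰
  inter_mem : ∀ s ∈ 𝒰, ∀ t ∈ 𝒰, s ∩ t ∈ 𝒰
  filterJoin_mem : ∀ s ∈ 𝒰, ∀ t ∈ 𝒰, filterJoin s t ∈ 𝒰
  boxR_mem : ∀ s ∈ 𝒰, boxR R s ∈ 𝒰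
  diaR_mem : ∀ s ∈ 𝒰, diaR R s ∈ 𝒰

namespace IsGeneralLFrame

variable {𝒰 : Set (Set X)}

/-- The family `𝒰` of a general frame, regarded as a modal lattice. -/
def Algebra (_h : IsGeneralLFrame R 𝒰) : Type v := 𝒰

variable (h : IsGeneralLFrame R 𝒰)

/-- An element of the algebra of a general frame, as a filter of the frame. -/
def filter (s : h.Algebra) : PFilter X := (h.isPFilter s.1 s.2).toPFilter

instance : PartialOrder h.Algebra := inferInstanceAs (PartialOrder 𝒰)

instance : ModalLattice h.Algebra where
  inf s t := ⟨s.1 ∩ t.1, h.inter_mem s.1 s.2 t.1 t.2⟩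
  inf_le_left s t := inter_subset_left (s := s.1)
  inf_le_right s t := inter_subset_right (s := s.1)
  le_inf _ _ _ hst hsr _ hx := ⟨hst hx, hsr hx⟩
  sup s t := ⟨filterJoin s.1 t.1, h.filterJoin_mem s.1 s.2 t.1 t.2⟩
  le_sup_left s t := le_pfilterJoin_left (F := h.filter s) (G := h.filter t)
  le_sup_right s t := le_pfilterJoin_right (F := h.filter s) (G := h.filter t)
  sup_le s t r := pfilterJoin_le (F := h.filter s) (G := h.filter t) (H := h.filter r)
  top := ⟨univ, h.univ_mem⟩
  le_top s := subset_univ s.1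
  bot := ⟨{⊤}, h.singleton_top_mem⟩
  bot_le s := singleton_subset_iff.2 (PFilter.top_mem (F := h.filter s))
  box s := ⟨boxR R s.1, h.boxR_mem s.1 s.2⟩
  dia s := ⟨diaR R s.1, h.diaR_mem s.1 s.2⟩
  box_top := Subtype.ext (eq_univ_of_forall fun _ _ _ => trivial)
  dia_top := Subtype.ext (eq_univ_of_forall fun x => (h.serial x).imp fun _ hy => ⟨hy, trivial⟩)
  box_inf_box s t := Subtype.ext (Set.ext fun x =>
    ⟨fun hx y hy => ⟨hx.1 y hy, hx.2 y hy⟩,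
      fun hx => ⟨fun y hy => (hx y hy).1, fun y hy => (hx y hy).2⟩⟩)
  dia_sup_dia_le s t := by
    refine pfilterJoin_le (F := (h.isPFilter _ (h.diaR_mem _ s.2)).toPFilter)
      (G := (h.isPFilter _ (h.diaR_mem _ t.2)).toPFilter)
      (H := (h.isPFilter _ (h.diaR_mem _ (h.filterJoin_mem _ s.2 _ t.2))).toPFilter) ?_ ?_
    · rintro x ⟨y, hxy, hy⟩
      exact ⟨y, hxy, le_pfilterJoin_left (F := h.filter s) (G := h.filter t) hy⟩
    · rintro x ⟨y, hxy, hy⟩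
      exact ⟨y, hxy, le_pfilterJoin_right (F := h.filter s) (G := h.filter t) hy⟩
  dia_inf_box_le s t := fun x ⟨⟨y, hxy, hy⟩, hx⟩ => ⟨y, hxy, hy, hx y hxy⟩

theorem mem_eval_iff (σ : P → h.Algebra) (φ : Form P) (x : X) :
    x ∈ (φ.eval σ).1 ↔ Forces R (fun q => h.filter (σ q)) x φ := by
  induction φ generalizing x with
  | var q => exact Iff.rfl
  | top => exact Iff.rfl
  | bot => exact Iff.rfl
  | and φ ψ hφ hψ => exact and_congr (hφ x) (hψ x)
  | or φ ψ hφ hψ =>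
    simp only [Forces, ← hφ, ← hψ]
    exact ⟨fun ⟨y, hy, z, hz, hx⟩ => ⟨y, z, hy, hz, hx⟩,
      fun ⟨y, z, hy, hz, hx⟩ => ⟨y, hy, z, hz, hx⟩⟩
  | box φ hφ => exact forall₂_congr fun y _ => hφ y
  | dia φ hφ => exact exists_congr fun y => and_congr_right fun _ => hφ y

theorem inVariety_algebra {Δ : Set (ConsequencePair P)}
    (hΔ : ∀ c ∈ Δ, ∀ (V : P → PFilter X) x, Forces R V x c.lhs → Forces R V x c.rhs) :
    InVariety Δ h.Algebra := fun c hc σ x hx => by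
  have hx' := (h.mem_eval_iff σ c.lhs x).1 hx
  exact (h.mem_eval_iff σ c.rhs x).2 (hΔ c hc _ x hx')

end IsGeneralLFrame

namespace IsModalLFrame

variable {s : Set X}

theorem serial (hR : IsModalLFrame R) (x : X) : ∃ y, R x y :=
  (hR.back_le x ⊤ ⊤ le_top ((hR.top_iff ⊤).2 rfl)).imp fun _ => And.left

theorem isPFilter_boxR (hR : IsModalLFrame R) (hs : IsPFilter s) : IsPFilter (boxR R s) := by
  rw [isPFilter_iff] at *
  obtain ⟨htop, hinf, hup⟩ := hs
  refine ⟨fun y hy => (hR.top_iff y).1 hy ▸ htop, fun x hx y hy z hz => ?_,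
    fun x y hxy hx z hz => ?_⟩
  · obtain ⟨u, v, hu, hv, huv⟩ := hR.of_inf x y z hz
    exact hup huv (hinf u (hx u hu) v (hy v hv))
  · obtain ⟨w, hw, hwz⟩ := hR.back_le x y z hxy hz
    exact hup hwz (hx w hw)

theorem isPFilter_diaR (hR : IsModalLFrame R) (hs : IsPFilter s) : IsPFilter (diaR R s) := by
  rw [isPFilter_iff] at *
  obtain ⟨htop, hinf, hup⟩ := hs
  refine ⟨⟨⊤, (hR.top_iff ⊤).2 rfl, htop⟩, ?_, ?_⟩
  · rintro x ⟨u, hu, hus⟩ y ⟨v, hv, hvs⟩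
    exact ⟨u ⊓ v, hR.inf x y u v hu hv, hinf u hus v hvs⟩
  · rintro x y hxy ⟨u, hu, hus⟩
    obtain ⟨z, hz, huz⟩ := hR.forth_le x y u hxy hu
    exact ⟨z, hz, hup huz hus⟩

theorem isGeneralLFrame (hR : IsModalLFrame R) : IsGeneralLFrame R {s : Set X | IsPFilter s} where
  serial := hR.serial
  isPFilter _ hs := hs
  univ_mem := isPFilter_univ
  singleton_top_mem := isPFilter_singleton_top
  inter_mem _ hs _ ht := isPFilter_inter_of_semilatticeInf hs ht
  filterJoin_mem _ hs _ ht := (pfilterJoin hs.toPFilter ht.toPFilter).isPFilter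
  boxR_mem _ hs := hR.isPFilter_boxR hs
  diaR_mem _ hs := hR.isPFilter_diaR hs

end IsModalLFrame

/-- The clopen filters of a topologized semilattice. -/
def clopenFilters (X : Type v) [SemilatticeInf X] [TopologicalSpace X] : Set (Set X) :=
  {s | IsPFilter s ∧ IsClopen s}

namespace IsModalLSpace

variable [TopologicalSpace X]

theorem isGeneralLFrame (hR : IsModalLSpace R) : IsGeneralLFrame R (clopenFilters X) where
  serial := hR.serial
  isPFilter _ hs := hs.1
  univ_mem := ⟨isPFilter_univ, isClopen_univ⟩
  singleton_top_mem := ⟨isPFilter_singleton_top, hR.isLSpace.isClopen_top⟩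
  inter_mem _ hs _ ht := ⟨isPFilter_inter_of_semilatticeInf hs.1 ht.1, hs.2.inter ht.2⟩
  filterJoin_mem _ hs _ ht := ⟨(pfilterJoin hs.1.toPFilter ht.1.toPFilter).isPFilter,
    hR.isLSpace.isClopen_join hs.1.toPFilter ht.1.toPFilter hs.2 ht.2⟩
  boxR_mem _ hs := hR.box_clopen hs.1.toPFilter hs.2
  diaR_mem _ hs := hR.dia_clopen hs.1.toPFilter hs.2

end IsModalLSpace

end GeneralFrames

/-! ### Algebraic soundness and completeness -/

section Logic

variable {P : Type u} {Q : Type v} {Δ : Set (ConsequencePair P)}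

namespace Form

/-- Simultaneous substitution of formulas over `Q` for the letters in a formula over `P`;
`Form.subst` is the case `P = Q`. -/
def bind (τ : P → Form Q) : Form P → Form Q
  | .var p => τ p
  | .top => .top
  | .bot => .bot
  | .and φ ψ => .and (φ.bind τ) (ψ.bind τ)
  | .or φ ψ => .or (φ.bind τ) (ψ.bind τ)
  | .box φ => .box (φ.bind τ)
  | .dia φ => .dia (φ.bind τ)

/-- The letters that occur in a formula. -/
def letters : Form P → List P
  | .var p => [p]
  | .top => []
  | .bot => []
  | .and φ ψ => φ.letters ++ ψ.letters
  | .or φ ψ => φ.letters ++ ψ.letters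
  | .box φ => φ.letters
  | .dia φ => φ.letters

theorem subst_eq_bind (σ : P → Form P) (φ : Form P) : φ.subst σ = φ.bind σ := by
  induction φ <;> simp only [subst, bind, *]

theorem bind_bind {S : Type w} (τ : P → Form Q) (ρ : Q → Form S) (φ : Form P) :
    (φ.bind τ).bind ρ = φ.bind fun p => (τ p).bind ρ := by
  induction φ <;> simp only [bind, *]

theorem bind_eq_self {τ : P → Form P} {φ : Form P} (h : ∀ p ∈ φ.letters, τ p = .var p) :
    φ.bind τ = φ := by
  induction φ <;> simp_all [bind, letters]

theorem eval_bind {A : Type w} [ModalLattice A] (τ : P → Form Q) (σ : Q → A) (φ : Form P) :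
    (φ.bind τ).eval σ = φ.eval fun p => (τ p).eval σ := by
  induction φ <;> simp only [bind, eval, *]

-- A formula has finitely many letters, and these can be renamed to letters in any universe.
theorem exists_bind_bind_eq_self (φ ψ : Form P) :
    ∃ (Q : Type v) (τ : P → Form Q) (ρ : Q → Form P),
      (φ.bind τ).bind ρ = φ ∧ (ψ.bind τ).bind ρ = ψ := by
  set l := φ.letters ++ ψ.letters with hl
  let ρ : ULift.{v} (Fin l.length) → Form P := fun i => .var (l.get i.down)
  have hρ (p : P) : ∃ θ : Form (ULift.{v} (Fin l.length)), p ∈ l → θ.bind ρ = .var p := by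
    by_cases hp : p ∈ l
    · obtain ⟨i, hi⟩ := List.get_of_mem hp
      exact ⟨.var ⟨i⟩, fun _ => congrArg Form.var hi⟩
    · exact ⟨.top, fun h => absurd h hp⟩
  choose τ hτ using hρ
  refine ⟨_, τ, ρ, ?_, ?_⟩ <;> rw [bind_bind] <;>
    exact bind_eq_self fun p hp => hτ p (by simp [hl, hp])

end Form

namespace Derives

theorem and_mono {φ φ' ψ ψ' : Form P} (h : Derives Δ φ φ') (h' : Derives Δ ψ ψ') :
    Derives Δ (.and φ ψ) (.and φ' ψ') :=
  .and_intro (.trans (.and_left _ _) h) (.trans (.and_right _ _) h')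

theorem or_mono {φ φ' ψ ψ' : Form P} (h : Derives Δ φ φ') (h' : Derives Δ ψ ψ') :
    Derives Δ (.or φ ψ) (.or φ' ψ') :=
  .or_elim (.trans h (.or_left _ _)) (.trans h' (.or_right _ _))

theorem eval_le {φ ψ : Form P} (h : Derives Δ φ ψ) {A : Type w} [ModalLattice A]
    (hA : InVariety Δ A) (σ : P → A) : φ.eval σ ≤ ψ.eval σ := by
  induction h generalizing σ with
  | ax hc => exact hA _ hc σ
  | subst τ _ ih =>
    simp only [Form.subst_eq_bind, Form.eval_bind]
    exact ih _
  | top => exact le_top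
  | bot => exact bot_le
  | refl => exact le_rfl
  | trans _ _ ih₁ ih₂ => exact (ih₁ σ).trans (ih₂ σ)
  | and_left => exact inf_le_left
  | and_right => exact inf_le_right
  | or_left => exact le_sup_left
  | or_right => exact le_sup_right
  | and_intro _ _ ih₁ ih₂ => exact le_inf (ih₁ σ) (ih₂ σ)
  | or_elim _ _ ih₁ ih₂ => exact sup_le (ih₁ σ) (ih₂ σ)
  | box_top => exact ModalLattice.box_top.ge
  | dia_top => exact ModalLattice.dia_top.ge
  | box_mono _ ih => exact ModalLattice.box_mono (ih σ)
  | dia_mono _ ih => exact ModalLattice.dia_mono (ih σ)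
  | linearity => exact (box_inf_box _ _).le
  | duality => exact dia_inf_box_le _ _

end Derives

/-- Formulas over `Q` up to interderivability in `L(Δ)` of their images under `ρ`. This is the
subalgebra of the Lindenbaum–Tarski algebra of `L(Δ)` generated by the classes of the formulas
`ρ q`; unlike the full algebra it lives in the universe of `Q`. -/
def lindenbaumSetoid (Δ : Set (ConsequencePair P)) (ρ : Q → Form P) : Setoid (Form Q) where
  r φ ψ := Derives Δ (φ.bind ρ) (ψ.bind ρ) ∧ Derives Δ (ψ.bind ρ) (φ.bind ρ)
  iseqv := ⟨fun _ => ⟨.refl _, .refl _⟩, And.symm,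
    fun h h' => ⟨h.1.trans h'.1, h'.2.trans h.2⟩⟩

/-- The algebra of formulas over `Q` modulo `lindenbaumSetoid`. -/
def Lindenbaum (Δ : Set (ConsequencePair P)) (ρ : Q → Form P) : Type v :=
  Quotient (lindenbaumSetoid Δ ρ)

namespace Lindenbaum

variable {ρ : Q → Form P}

/-- The class of a formula in the Lindenbaum algebra. -/
def mk (φ : Form Q) : Lindenbaum Δ ρ := Quotient.mk (lindenbaumSetoid Δ ρ) φ

theorem mk_surjective : Function.Surjective (mk : Form Q → Lindenbaum Δ ρ) :=
  Quotient.mk_surjective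

instance : ModalLattice (Lindenbaum Δ ρ) where
  le := Quotient.lift₂ (fun φ ψ => Derives Δ (φ.bind ρ) (ψ.bind ρ))
    fun _ _ _ _ h h' => propext ⟨fun d => h.2.trans (d.trans h'.1),
      fun d => h.1.trans (d.trans h'.2)⟩
  le_refl := by rintro ⟨φ⟩; exact .refl _
  le_trans := by rintro ⟨φ⟩ ⟨ψ⟩ ⟨χ⟩; exact .trans
  le_antisymm := by rintro ⟨φ⟩ ⟨ψ⟩ h h'; exact Quotient.sound ⟨h, h'⟩
  inf := Quotient.map₂ .and fun _ _ h _ _ h' => ⟨h.1.and_mono h'.1, h.2.and_mono h'.2⟩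
  sup := Quotient.map₂ .or fun _ _ h _ _ h' => ⟨h.1.or_mono h'.1, h.2.or_mono h'.2⟩
  inf_le_left := by rintro ⟨φ⟩ ⟨ψ⟩; exact .and_left _ _
  inf_le_right := by rintro ⟨φ⟩ ⟨ψ⟩; exact .and_right _ _
  le_inf := by rintro ⟨φ⟩ ⟨ψ⟩ ⟨χ⟩; exact .and_intro
  le_sup_left := by rintro ⟨φ⟩ ⟨ψ⟩; exact .or_left _ _
  le_sup_right := by rintro ⟨φ⟩ ⟨ψ⟩; exact .or_right _ _
  sup_le := by rintro ⟨φ⟩ ⟨ψ⟩ ⟨χ⟩; exact .or_elim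
  top := mk .top
  bot := mk .bot
  le_top := by rintro ⟨φ⟩; exact .top _
  bot_le := by rintro ⟨φ⟩; exact .bot _
  box := Quotient.map .box fun _ _ h => ⟨h.1.box_mono, h.2.box_mono⟩
  dia := Quotient.map .dia fun _ _ h => ⟨h.1.dia_mono, h.2.dia_mono⟩
  box_top := Quotient.sound ⟨.top _, .box_top⟩
  dia_top := Quotient.sound ⟨.top _, .dia_top⟩
  box_inf_box := by
    rintro ⟨φ⟩ ⟨ψ⟩
    exact Quotient.sound ⟨.linearity _ _,
      .and_intro (.box_mono (.and_left _ _)) (.box_mono (.and_right _ _))⟩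
  dia_sup_dia_le := by
    rintro ⟨φ⟩ ⟨ψ⟩
    exact .or_elim (.dia_mono (.or_left _ _)) (.dia_mono (.or_right _ _))
  dia_inf_box_le := by rintro ⟨φ⟩ ⟨ψ⟩; exact .duality _ _

theorem mk_le_mk {φ ψ : Form Q} :
    (mk φ : Lindenbaum Δ ρ) ≤ mk ψ ↔ Derives Δ (φ.bind ρ) (ψ.bind ρ) := Iff.rfl

theorem eval_mk {S : Type w} (τ : S → Form Q) (φ : Form S) :
    φ.eval (fun s => (mk (τ s) : Lindenbaum Δ ρ)) = mk (φ.bind τ) := by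
  induction φ with
  | var | top | bot => rfl
  | and φ ψ hφ hψ | or φ ψ hφ hψ =>
    simp only [Form.eval, hφ, hψ]
    rfl
  | box φ hφ | dia φ hφ =>
    simp only [Form.eval, hφ]
    rfl

theorem inVariety : InVariety Δ (Lindenbaum Δ ρ) := by
  intro c hc σ
  obtain ⟨τ, rfl⟩ := mk_surjective.comp_left σ
  simp only [Function.comp_def, eval_mk, mk_le_mk, Form.bind_bind, ← Form.subst_eq_bind]
  exact .subst _ (.ax hc)

end Lindenbaum

theorem derives_of_forall_eval_le {φ ψ : Form P}
    (h : ∀ (A : Type v) [ModalLattice A], InVariety Δ A → ∀ σ : P → A, φ.eval σ ≤ ψ.eval σ) :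
    Derives Δ φ ψ := by
  obtain ⟨Q, τ, ρ, hφ, hψ⟩ := Form.exists_bind_bind_eq_self.{u, v} φ ψ
  have hle := h (Lindenbaum Δ ρ) Lindenbaum.inVariety fun p => .mk (τ p)
  rwa [Lindenbaum.eval_mk, Lindenbaum.eval_mk, Lindenbaum.mk_le_mk, hφ, hψ] at hle

end Logic

/-! ### The dual frame of a modal lattice -/

section DualFrame

/-- The filter of all filters that contain `a`. -/
def containing {A : Type w} [Preorder A] (a : A) : PFilter (PFilter A) :=
  PFilter.principal (PFilter.principal a)

theorem mem_containing {A : Type w} [Preorder A] {F : PFilter A} {a : A} :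
    F ∈ containing a ↔ a ∈ F :=
  PFilter.mem_principal.trans PFilter.principal_le_iff

section BoundedLattice

variable {A : Type w} [Lattice A] [BoundedOrder A] {F : PFilter A} {a b : A}

theorem pfilter_eq_top_iff_bot_mem : F = ⊤ ↔ ⊥ ∈ F := by
  refine ⟨?_, fun h => top_le_iff.1 fun _ _ => PFilter.mem_of_le bot_le h⟩
  rintro rfl
  trivial

theorem principal_inf_principal_le_iff :
    PFilter.principal a ⊓ PFilter.principal b ≤ F ↔ a ⊔ b ∈ F :=
  ⟨fun h => h ⟨le_sup_left, le_sup_right⟩,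
    fun h _ hc => PFilter.mem_of_le (sup_le hc.1 hc.2) h⟩

end BoundedLattice

variable {A : Type w} [ModalLattice A] {F G H : PFilter A} {a : A}

/-- The filter `{a | □a ∈ F}`, which is the least successor of `F` under `dualRel A`. -/
def boxPreimage (F : PFilter A) : PFilter A :=
  (isPFilter_preimage (⟨⟨(box : A → A), fun a b => (box_inf_box a b).symm⟩, box_top⟩ :
    InfTopHom A A) F.isPFilter).toPFilter

theorem dualRel_boxPreimage (F : PFilter A) : dualRel A F (boxPreimage F) :=
  fun a => ⟨id, PFilter.mem_of_le (box_le_dia a)⟩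

theorem dualRel_pfilterJoin (h : ∀ a ∈ G, dia a ∈ F) :
    dualRel A F (pfilterJoin (boxPreimage F) G) := by
  refine fun a => ⟨fun ha => le_pfilterJoin_left ha, fun ha => ?_⟩
  obtain ⟨b, hb, c, hc, hbc⟩ := mem_pfilterJoin.1 ha
  have hle : dia c ⊓ box b ≤ dia a :=
    (dia_inf_box_le c b).trans (dia_mono (inf_comm c b ▸ hbc))
  exact PFilter.mem_of_le hle (PFilter.inf_mem (h c hc) hb)

variable (A) in
theorem isModalLFrame_dualRel : IsModalLFrame (dualRel A) where
  back_le F F' G h hG := ⟨boxPreimage F, dualRel_boxPreimage F, fun a ha => (hG a).1 (h ha)⟩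
  forth_le F F' H h hH := ⟨pfilterJoin (boxPreimage F') H,
    dualRel_pfilterJoin fun a ha => h ((hH a).2 ha), le_pfilterJoin_right⟩
  of_inf F F' G hG := ⟨boxPreimage F, boxPreimage F', dualRel_boxPreimage F,
    dualRel_boxPreimage F', fun a ha => (hG a).1 ⟨ha.1, ha.2⟩⟩
  inf F F' G G' h h' := fun a => ⟨fun ha => ⟨(h a).1 ha.1, (h' a).1 ha.2⟩,
    fun ha => ⟨(h a).2 ha.1, (h' a).2 ha.2⟩⟩
  top_iff G := by
    refine ⟨fun h => pfilter_eq_top_iff_bot_mem.2 ((h ⊥).1 trivial), ?_⟩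
    rintro rfl
    exact fun a => ⟨fun _ => trivial, fun _ => trivial⟩

theorem box_mem_iff : box a ∈ F ↔ ∀ G, dualRel A F G → a ∈ G :=
  ⟨fun h _ hG => (hG a).1 h, fun h => h _ (dualRel_boxPreimage F)⟩

theorem dia_mem_iff : dia a ∈ F ↔ ∃ G, dualRel A F G ∧ a ∈ G := by
  refine ⟨fun h => ⟨pfilterJoin (boxPreimage F) (PFilter.principal a),
    dualRel_pfilterJoin fun b hb => PFilter.mem_of_le (dia_mono hb) h,
    PFilter.principal_le_iff.1 le_pfilterJoin_right⟩, ?_⟩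
  rintro ⟨G, hG, ha⟩
  exact (hG a).2 ha

theorem forces_dualRel_iff {P : Type u} (σ : P → A) (φ : Form P) (F : PFilter A) :
    Forces (dualRel A) (fun q => containing (σ q)) F φ ↔ φ.eval σ ∈ F := by
  induction φ generalizing F with
  | var q => exact mem_containing
  | top => exact iff_of_true trivial PFilter.top_mem
  | bot => exact pfilter_eq_top_iff_bot_mem
  | and φ ψ hφ hψ => simp only [Forces, Form.eval, PFilter.inf_mem_iff, hφ, hψ]
  | or φ ψ hφ hψ =>
    simp only [Forces, Form.eval, hφ, hψ, ← principal_inf_principal_le_iff]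
    refine ⟨fun ⟨G, H, hG, hH, h⟩ => le_trans (inf_le_inf ?_ ?_) h,
      fun h => ⟨_, _, PFilter.mem_principal.2 le_rfl, PFilter.mem_principal.2 le_rfl, h⟩⟩
    · exact PFilter.principal_le_iff.2 hG
    · exact PFilter.principal_le_iff.2 hH
  | box φ hφ => simp only [Forces, Form.eval, box_mem_iff, hφ]
  | dia φ hφ => simp only [Forces, Form.eval, dia_mem_iff, hφ]

/-- The modal L-frame of the filters of a modal lattice. -/
def dualFrame (A : Type w) [ModalLattice A] : ModalLFrame where
  carrier := PFilter A
  rel := dualRel A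
  isModalLFrame := isModalLFrame_dualRel A

/-! ### Correspondence -/

theorem dualRel_refl (hbox : ∀ a : A, box a ≤ a) (hdia : ∀ a : A, a ≤ dia a) (F : PFilter A) :
    dualRel A F F :=
  fun a => ⟨PFilter.mem_of_le (hbox a), PFilter.mem_of_le (hdia a)⟩

theorem dualRel_trans (hbox : ∀ a : A, box a ≤ box (box a)) (hdia : ∀ a : A, dia (dia a) ≤ dia a)
    (hFG : dualRel A F G) (hGH : dualRel A G H) : dualRel A F H :=
  fun a => ⟨fun h => (hGH a).1 ((hFG _).1 (PFilter.mem_of_le (hbox a) h)),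
    fun h => PFilter.mem_of_le (hdia a) ((hFG _).2 ((hGH a).2 h))⟩

theorem dualRel_symm (hbox : ∀ a : A, a ≤ box (dia a)) (hdia : ∀ a : A, dia (box a) ≤ a)
    (hFG : dualRel A F G) : dualRel A G F :=
  fun a => ⟨fun h => PFilter.mem_of_le (hdia a) ((hFG _).2 h),
    fun h => (hFG _).1 (PFilter.mem_of_le (hbox a) h)⟩

theorem dualRel_euclidean (hbox : ∀ a : A, dia a ≤ box (dia a))
    (hdia : ∀ a : A, dia (box a) ≤ box a) (hFG : dualRel A F G) (hFH : dualRel A F H) :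
    dualRel A G H :=
  fun a => ⟨fun h => (hFH a).1 (PFilter.mem_of_le (hdia a) ((hFG _).2 h)),
    fun h => (hFG _).1 (PFilter.mem_of_le (hbox a) ((hFH a).2 h))⟩

theorem exists_dualRel_of_dualRel (hdia : ∀ a : A, dia (box a) ≤ box (dia a))
    (hFG : dualRel A F G) (hFH : dualRel A F H) : ∃ K, dualRel A G K ∧ dualRel A H K := by
  refine ⟨pfilterJoin (boxPreimage G) (boxPreimage H), dualRel_pfilterJoin fun a ha => ?_,
    pfilterJoin_comm (F := boxPreimage G) ▸ dualRel_pfilterJoin fun a ha => ?_⟩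
  · exact (hFG _).1 (PFilter.mem_of_le (hdia a) ((hFH _).2 ha))
  · exact (hFH _).1 (PFilter.mem_of_le (hdia a) ((hFG _).2 ha))

variable {P : Type u} {p : P}

theorem AxiomName.condition_dualRel {n : AxiomName} (h : InVariety (n.pairs p) A) :
    n.Condition (dualRel A) := by
  cases n with
  | T =>
    exact dualRel_refl (fun a => h _ (.inl rfl) fun _ => a) (fun a => h _ (.inr rfl) fun _ => a)
  | four =>
    exact fun _ _ _ =>
      dualRel_trans (fun a => h _ (.inl rfl) fun _ => a) (fun a => h _ (.inr rfl) fun _ => a)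
  | B =>
    exact fun _ _ =>
      dualRel_symm (fun a => h _ (.inl rfl) fun _ => a) (fun a => h _ (.inr rfl) fun _ => a)
  | five =>
    exact fun _ _ _ =>
      dualRel_euclidean (fun a => h _ (.inl rfl) fun _ => a) (fun a => h _ (.inr rfl) fun _ => a)
  | dotTwo => exact fun _ _ _ => exists_dualRel_of_dualRel fun a => h _ rfl fun _ => a

theorem theta_dualRel {Γ : Set AxiomName} (h : InVariety (axiomPairs p Γ) A) :
    Theta Γ (dualRel A) :=
  fun _ hn => AxiomName.condition_dualRel fun c hc => h c (mem_biUnion hn hc)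

end DualFrame

section Correspondence

variable {P : Type u} {p : P} {X : Type v} [SemilatticeInf X] [OrderTop X] {R : X → X → Prop}
  {c : ConsequencePair P}

theorem AxiomName.Condition.forces {n : AxiomName} (hn : n.Condition R) (hc : c ∈ n.pairs p)
    (V : P → PFilter X) (x : X) (hx : Forces R V x c.lhs) : Forces R V x c.rhs := by
  cases n with simp only [AxiomName.pairs, mem_insert_iff, mem_singleton_iff] at hc
  | T =>
    rcases hc with rfl | rfl
    · exact hx x (hn x)
    · exact ⟨x, hn x, hx⟩
  | four =>
    rcases hc with rfl | rfl
    · exact fun y hxy z hyz => hx z (hn x y z hxy hyz)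
    · obtain ⟨y, hxy, z, hyz, hz⟩ := hx
      exact ⟨z, hn x y z hxy hyz, hz⟩
  | B =>
    rcases hc with rfl | rfl
    · exact fun y hxy => ⟨x, hn x y hxy, hx⟩
    · obtain ⟨y, hxy, hy⟩ := hx
      exact hy x (hn x y hxy)
  | five =>
    rcases hc with rfl | rfl
    · obtain ⟨y, hxy, hy⟩ := hx
      exact fun z hxz => ⟨y, hn x z y hxz hxy, hy⟩
    · obtain ⟨y, hxy, hy⟩ := hx
      exact fun z hxz => hy z (hn x y z hxy hxz)
  | dotTwo =>
    subst hc
    obtain ⟨y, hxy, hy⟩ := hx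
    intro z hxz
    obtain ⟨t, hyt, hzt⟩ := hn x y z hxy hxz
    exact ⟨t, hzt, hy t hyt⟩

theorem Theta.forces {Γ : Set AxiomName} (hΓ : Theta Γ R) (hc : c ∈ axiomPairs p Γ)
    (V : P → PFilter X) (x : X) (hx : Forces R V x c.lhs) : Forces R V x c.rhs := by
  simp only [axiomPairs, mem_iUnion] at hc
  obtain ⟨n, hn, hc⟩ := hc
  exact (hΓ n hn).forces hc V x hx

end Correspondence

/-! ### Soundness and completeness for modal L-frames -/

section FrameCompleteness

variable {P : Type u} {Δ : Set (ConsequencePair P)}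

theorem Derives.validates {φ ψ : Form P} (h : Derives Δ φ ψ) {F : ModalLFrame.{v}}
    (hF : ∀ c ∈ Δ, F.Validates c.lhs c.rhs) : F.Validates φ ψ := by
  intro V x hx
  have hgen := F.isModalLFrame.isGeneralLFrame
  let σ : P → hgen.Algebra := fun q => ⟨V q, (V q).isPFilter⟩
  exact (hgen.mem_eval_iff σ ψ x).1
    (h.eval_le (hgen.inVariety_algebra hF) σ ((hgen.mem_eval_iff σ φ x).2 hx))

theorem soundAndComplete_of_dualFrame_mem {C : Set ModalLFrame.{v}}
    (hsound : ∀ F ∈ C, ∀ c ∈ Δ, F.Validates c.lhs c.rhs)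
    (hdual : ∀ (A : Type v) [ModalLattice A], InVariety Δ A → dualFrame A ∈ C) :
    SoundAndComplete Δ C := by
  refine fun φ ψ => ⟨fun h => derives_of_forall_eval_le.{u, v} fun A _ hA σ => ?_,
    fun h F hF => h.validates (hsound F hF)⟩
  rw [← PFilter.mem_principal, ← forces_dualRel_iff]
  refine h _ (hdual A hA) _ _ ?_
  exact (forces_dualRel_iff σ φ _).2 (PFilter.mem_principal.2 le_rfl)

theorem soundAndComplete_theta (p : P) (Γ : Set AxiomName) :
    SoundAndComplete (axiomPairs p Γ) {F : ModalLFrame.{v} | Theta Γ F.rel} :=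
  soundAndComplete_of_dualFrame_mem (fun _ hF _ hc => hF.forces hc) fun _ _ => theta_dualRel

end FrameCompleteness

/-! ### Compactness -/

section Compactness

theorem closedIicTopology_of_priestleySpace (α : Type*) [TopologicalSpace α] [Preorder α]
    [PriestleySpace α] : ClosedIicTopology α where
  isClosed_Iic a := by
    rw [← isOpen_compl_iff, isOpen_iff_mem_nhds]
    intro x hx
    obtain ⟨U, hU, hup, hxU, haU⟩ := exists_isClopen_upper_of_not_le hx
    exact Filter.mem_of_superset (hU.isOpen.mem_nhds hxU) fun y hy hya => haU (hup hya hy)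

theorem exists_isLeast_of_isCompact_of_directedOn {α : Type*} [TopologicalSpace α] [Preorder α]
    [ClosedIicTopology α] {s : Set α} (hs : IsCompact s) (hne : s.Nonempty)
    (hdir : DirectedOn (· ≥ ·) s) : ∃ x, IsLeast s x := by
  have : Nonempty s := hne.to_subtype
  by_contra! hleast
  have hempty : s ∩ ⋂ x : s, Iic (x : α) = ∅ := by
    refine eq_empty_of_forall_notMem fun x hx => hleast x ⟨hx.1, fun y hy => ?_⟩
    exact mem_iInter.1 hx.2 ⟨y, hy⟩
  obtain ⟨x, hx⟩ := hs.elim_directed_family_closed _ (fun x : s => isClosed_Iic) hempty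
    (hdir.directed_val.mono_comp (g := Iic) (· ≥ ·) fun _ _ h => Iic_subset_Iic.2 h)
  exact hx.subset ⟨x.2, le_rfl⟩

namespace IsHMSSpace

variable {X : Type w} [SemilatticeInf X] [OrderTop X] [TopologicalSpace X]

theorem priestleySpace (hX : IsHMSSpace X) : PriestleySpace X where
  priestley hxy := by
    obtain ⟨U, hU, hx, hy⟩ := hX.separation _ _ hxy
    exact ⟨U, hU, (isPFilter_iff.1 U.isPFilter).2.2, hx, hy⟩

theorem exists_eq_Ici (hX : IsHMSSpace X) {s : Set X} (hs : IsPFilter s) (hclosed : IsClosed s) :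
    ∃ x, s = Ici x := by
  have := hX.compact
  have := hX.priestleySpace
  have := closedIicTopology_of_priestleySpace X
  obtain ⟨x, hx, hle⟩ := exists_isLeast_of_isCompact_of_directedOn hclosed.isCompact
    hs.toPFilter.nonempty hs.toPFilter.directed
  exact ⟨x, Subset.antisymm hle ((isPFilter_iff.1 hs).2.2.Ici_subset hx)⟩

end IsHMSSpace

end Compactness

/-! ### The dual space of a modal lattice -/

section DualSpace

section BoundedLattice

variable {A : Type w} [Lattice A] [BoundedOrder A]

theorem isClopen_containing (a : A) : IsClopen (containing a : Set (PFilter A)) := by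
  have hset : (containing a : Set (PFilter A)) = {F | a ∈ F} := Set.ext fun _ => mem_containing
  rw [hset]
  exact ⟨⟨TopologicalSpace.isOpen_generateFrom_of_mem ⟨a, .inr rfl⟩⟩,
    TopologicalSpace.isOpen_generateFrom_of_mem ⟨a, .inl rfl⟩⟩

theorem isHMSSpace_pfilter : IsHMSSpace (PFilter A) where
  compact := by
    refine ⟨isCompact_iff_ultrafilter_le_nhds.2 fun u _ => ?_⟩
    have hlim : IsPFilter {a : A | ∀ᶠ G : PFilter A in u, a ∈ G} := by
      refine isPFilter_iff.2 ⟨.of_forall fun _ => PFilter.top_mem, fun a ha b hb => ?_,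
        fun a b hab ha => ha.mono fun _ => PFilter.mem_of_le hab⟩
      exact (ha.and hb).mono fun G h => PFilter.inf_mem h.1 h.2
    refine ⟨hlim.toPFilter, mem_univ _, ?_⟩
    rw [← Filter.tendsto_id', TopologicalSpace.tendsto_nhds_generateFrom_iff]
    rintro s ⟨a, rfl | rfl⟩ ha
    · exact ha
    · exact Ultrafilter.compl_mem_iff_notMem.2 ha
  separation F G h := by
    obtain ⟨a, haF, haG⟩ := SetLike.not_le_iff_exists.1 h
    exact ⟨containing a, isClopen_containing a, mem_containing.2 haF, mt mem_containing.1 haG⟩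

theorem exists_eq_containing {U : PFilter (PFilter A)} (hU : IsClopen (U : Set (PFilter A))) :
    ∃ a : A, U = containing a := by
  have := (isHMSSpace_pfilter (A := A)).compact
  obtain ⟨G, hG⟩ := isHMSSpace_pfilter.exists_eq_Ici U.isPFilter hU.isClosed
  have : Nonempty G := G.nonempty.to_subtype
  have hdir : Directed (· ⊇ ·) fun a : G => (containing a.1 : Set (PFilter A)) :=
    G.directed.directed_val.mono_comp (g := fun a => (containing a : Set (PFilter A))) (· ≥ ·)
      fun _ _ h F hF => mem_containing.2 (PFilter.mem_of_le h (mem_containing.1 hF))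
  have hinter : ∀ F ∈ ⋂ a : G, (containing a.1 : Set (PFilter A)), F ∈ (U : Set (PFilter A)) :=
    fun F hF => hG ▸ fun a ha => mem_containing.1 (mem_iInter.1 hF ⟨a, ha⟩)
  obtain ⟨a, ha⟩ := exists_subset_nhds_of_compactSpace hdir
    (fun a => (isClopen_containing a.1).isClosed)
    fun F hF => hU.isOpen.mem_nhds (hinter F hF)
  refine ⟨a, SetLike.coe_injective (Subset.antisymm ?_ ha)⟩
  exact hG ▸ fun F hF => mem_containing.2 (hF a.2)

theorem filterJoin_containing (a b : A) :
    filterJoin (containing a : Set (PFilter A)) (containing b) = containing (a ⊔ b) := by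
  ext F
  rw [SetLike.mem_coe, mem_containing, ← principal_inf_principal_le_iff]
  exact ⟨fun ⟨G, hG, H, hH, h⟩ => (inf_le_inf hG hH).trans h,
    fun h => ⟨_, PFilter.mem_principal.2 le_rfl, _, PFilter.mem_principal.2 le_rfl, h⟩⟩

theorem isLSpace_pfilter : IsLSpace (PFilter A) where
  toIsHMSSpace := isHMSSpace_pfilter
  isClopen_top := by
    convert isClopen_containing (⊥ : A) using 1
    ext F
    exact pfilter_eq_top_iff_bot_mem.trans mem_containing.symm
  isClopen_join U V hU hV := by
    obtain ⟨a, rfl⟩ := exists_eq_containing hU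
    obtain ⟨b, rfl⟩ := exists_eq_containing hV
    exact filterJoin_containing a b ▸ isClopen_containing (a ⊔ b)

end BoundedLattice

variable {A : Type w} [ModalLattice A]

theorem boxR_containing (a : A) :
    boxR (dualRel A) (containing a : Set (PFilter A)) = containing (box a) := by
  ext F
  simp only [boxR, SetLike.mem_coe, mem_containing, mem_ofPred_eq, box_mem_iff]

theorem diaR_containing (a : A) :
    diaR (dualRel A) (containing a : Set (PFilter A)) = containing (dia a) := by
  ext F
  simp only [diaR, SetLike.mem_coe, mem_containing, mem_ofPred_eq, dia_mem_iff]

variable (A) in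
theorem isModalLSpace_dualRel : IsModalLSpace (dualRel A) where
  isLSpace := isLSpace_pfilter
  serial := (isModalLFrame_dualRel A).serial
  top_iff := (isModalLFrame_dualRel A).top_iff
  box_clopen U hU := by
    obtain ⟨a, rfl⟩ := exists_eq_containing hU
    exact boxR_containing a ▸ ⟨PFilter.isPFilter _, isClopen_containing _⟩
  dia_clopen U hU := by
    obtain ⟨a, rfl⟩ := exists_eq_containing hU
    exact diaR_containing a ▸ ⟨PFilter.isPFilter _, isClopen_containing _⟩
  rel_iff F G := by
    refine ⟨fun h U hU => ?_, fun h a => ?_⟩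
    · obtain ⟨a, rfl⟩ := exists_eq_containing hU
      simpa only [boxR_containing, diaR_containing, SetLike.mem_coe, mem_containing] using h a
    · simpa only [boxR_containing, diaR_containing, SetLike.mem_coe, mem_containing] using
        h _ (isClopen_containing a)

end DualSpace

/-! ### Representation of HMS-spaces by their clopen filters -/

section Representation

variable {X : Type w} [SemilatticeInf X] [OrderTop X] [TopologicalSpace X] {x y : X}

/-- The filter of all clopen filters that contain the point `x`. -/
def pointFilter (x : X) : PFilter (clopenFilters X) :=
  (IsPFilter.of_def (F := {U : clopenFilters X | x ∈ U.1})
    ⟨⟨univ, isPFilter_univ, isClopen_univ⟩, trivial⟩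
    (fun U hU V hV => ⟨⟨U.1 ∩ V.1, isPFilter_inter_of_semilatticeInf U.2.1 V.2.1,
      U.2.2.inter V.2.2⟩, ⟨hU, hV⟩, fun _ h => h.1, fun _ h => h.2⟩)
    fun h hx => h hx).toPFilter

theorem mem_pointFilter {U : clopenFilters X} : U ∈ pointFilter x ↔ x ∈ U.1 := Iff.rfl

theorem pointFilter_le_pointFilter_iff (hX : IsHMSSpace X) :
    pointFilter x ≤ pointFilter y ↔ x ≤ y := by
  refine ⟨fun h => ?_, fun h U hU => (isPFilter_iff.1 U.2.1).2.2 h hU⟩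
  by_contra hxy
  obtain ⟨U, hU, hx, hy⟩ := hX.separation x y hxy
  exact hy (h (x := ⟨U, U.isPFilter, hU⟩) hx)

theorem pointFilter_surjective (hX : IsHMSSpace X) :
    Function.Surjective (pointFilter : X → PFilter (clopenFilters X)) := by
  intro F
  have := hX.compact
  have : Nonempty F := F.nonempty.to_subtype
  have hclosed (U : F) : IsClosed (U : Set X) := U.1.2.2.isClosed
  have hfilter : IsPFilter (⋂ U : F, (U : Set X)) := by
    simp only [isPFilter_iff, mem_iInter]
    have hU (U : F) := isPFilter_iff.1 U.1.2.1
    exact ⟨fun U => (hU U).1, fun x hx y hy U => (hU U).2.1 x (hx U) y (hy U),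
      isUpperSet_iInter fun U => (hU U).2.2⟩
  obtain ⟨x, hx⟩ := hX.exists_eq_Ici hfilter (isClosed_iInter hclosed)
  refine ⟨x, SetLike.ext fun U => mem_pointFilter.trans ⟨fun hxU => ?_, fun hU => ?_⟩⟩
  · obtain ⟨V, hVU⟩ := exists_subset_nhds_of_compactSpace
      (F.directed.directed_val.mono_comp (g := fun V => (V : Set X)) (· ≥ ·) fun _ _ h => h)
      hclosed fun y hy => U.2.2.isOpen.mem_nhds ((isPFilter_iff.1 U.2.1).2.2 (hx.subset hy) hxU)
    exact PFilter.mem_of_le (x := V.1) hVU V.2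
  · exact mem_iInter.1 (hx.superset self_mem_Ici) ⟨U, hU⟩

/-- An HMS-space is order isomorphic to the filters of its semilattice of clopen filters. -/
noncomputable def pointFilterIso (hX : IsHMSSpace X) : X ≃o PFilter (clopenFilters X) :=
  RelIso.ofSurjective (OrderEmbedding.ofMapLEIff pointFilter fun _ _ =>
    pointFilter_le_pointFilter_iff hX) (pointFilter_surjective hX)

end Representation

/-! ### Isomorphisms of modal L-spaces -/

section Surjections

variable {X : Type v} {Y : Type w} {R : X → X → Prop} {S : Y → Y → Prop} {f : X → Y}

theorem AxiomName.Condition.of_surjective (hf : Function.Surjective f)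
    (h : ∀ x y, R x y ↔ S (f x) (f y)) {n : AxiomName} (hn : n.Condition S) : n.Condition R := by
  cases n <;> simpa only [AxiomName.Condition, h, hf.forall, hf.exists] using hn

theorem Theta.of_surjective (hf : Function.Surjective f) (h : ∀ x y, R x y ↔ S (f x) (f y))
    {Γ : Set AxiomName} (hΓ : Theta Γ S) : Theta Γ R :=
  fun n hn => (hΓ n hn).of_surjective hf h

theorem boxR_preimage (hf : Function.Surjective f) (h : ∀ x y, R x y ↔ S (f x) (f y))
    (s : Set Y) : boxR R (f ⁻¹' s) = f ⁻¹' boxR S s := by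
  ext x
  simp only [boxR, mem_preimage, mem_ofPred_eq, h, hf.forall]

theorem diaR_preimage (hf : Function.Surjective f) (h : ∀ x y, R x y ↔ S (f x) (f y))
    (s : Set Y) : diaR R (f ⁻¹' s) = f ⁻¹' diaR S s := by
  ext x
  simp only [diaR, mem_preimage, mem_ofPred_eq, h, hf.exists]

end Surjections

section Isomorphisms

variable {X Y : Type w} [SemilatticeInf X] [SemilatticeInf Y] {R : X → X → Prop} {S : Y → Y → Prop}

theorem IsLMorphism.monotone [OrderTop X] [OrderTop Y] {f : X → Y} (hf : IsLMorphism f) :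
    Monotone f := fun x y h => by
  rw [← inf_eq_left, ← hf.map_inf, inf_eq_left.2 h]

theorem filterJoin_preimage (f : X ≃o Y) (s t : Set Y) :
    filterJoin (f ⁻¹' s) (f ⁻¹' t) = f ⁻¹' filterJoin s t := by
  ext x
  simp only [filterJoin, mem_preimage, mem_ofPred_eq, f.surjective.exists, ← f.map_inf,
    f.le_iff_le]

variable [OrderTop X] [OrderTop Y] [TopologicalSpace X] [TopologicalSpace Y]

theorem isModalLSpaceMorphism_of_orderIso {f : X ≃o Y} (hf : Continuous f)
    (h : ∀ x y, R x y ↔ S (f x) (f y)) : IsModalLSpaceMorphism R S f where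
  map_top := f.map_top
  map_inf := f.map_inf
  eq_top x hx := (map_eq_top_iff f).1 hx
  inf_le x y z hyz := ⟨f.symm y, f.symm z, (f.apply_symm_apply y).ge, (f.apply_symm_apply z).ge, by
    rwa [← f.symm.map_inf, f.symm_apply_le]⟩
  continuous := hf
  map_rel x y := (h x y).1
  back_le x z hz := ⟨f.symm z, (h _ _).2 (by rwa [f.apply_symm_apply]), (f.apply_symm_apply z).le⟩
  back_ge x z hz := ⟨f.symm z, (h _ _).2 (by rwa [f.apply_symm_apply]), (f.apply_symm_apply z).ge⟩

theorem modalLSpaceIso_iff_exists_orderIso : ModalLSpaceIso R S ↔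
    ∃ f : X ≃o Y, Continuous f ∧ Continuous f.symm ∧ ∀ x y, R x y ↔ S (f x) (f y) := by
  constructor
  · rintro ⟨f, g, hf, hg, hgf, hfg⟩
    refine ⟨⟨⟨f, g, hgf, hfg⟩, fun {x y} => ⟨fun h => ?_, fun h => hf.monotone h⟩⟩,
      hf.continuous, hg.continuous, fun x y => ⟨hf.map_rel x y, fun h => ?_⟩⟩
    · exact hgf x ▸ hgf y ▸ hg.monotone h
    · exact hgf x ▸ hgf y ▸ hg.map_rel _ _ h
  · rintro ⟨f, hf, hf', h⟩
    refine ⟨f, f.symm, isModalLSpaceMorphism_of_orderIso hf h,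
      isModalLSpaceMorphism_of_orderIso hf' fun x y => ?_, f.left_inv, f.right_inv⟩
    rw [h, f.apply_symm_apply, f.apply_symm_apply]

theorem exists_isClopen_preimage_eq (f : X ≃o Y) (hf : Continuous f.symm) {U : PFilter X}
    (hU : IsClopen (U : Set X)) : ∃ V : PFilter Y, IsClopen (V : Set Y) ∧ f ⁻¹' V = (U : Set X) :=
  ⟨(isPFilter_preimage f.symm U.isPFilter).toPFilter, hU.preimage hf,
    f.toEquiv.preimage_symm_preimage U⟩

theorem IsHMSSpace.of_orderIso (hY : IsHMSSpace Y) (f : X ≃o Y) (hf : Continuous f)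
    (hf' : Continuous f.symm) : IsHMSSpace X where
  compact := by
    have := hY.compact
    exact f.symm.surjective.compactSpace hf'
  separation x y h := by
    obtain ⟨U, hU, hx, hy⟩ := hY.separation (f x) (f y) (mt f.le_iff_le.1 h)
    exact ⟨(isPFilter_preimage f U.isPFilter).toPFilter, hU.preimage hf, hx, hy⟩

theorem IsLSpace.of_orderIso (hY : IsLSpace Y) (f : X ≃o Y) (hf : Continuous f)
    (hf' : Continuous f.symm) : IsLSpace X where
  toIsHMSSpace := hY.toIsHMSSpace.of_orderIso f hf hf'
  isClopen_top := by
    convert hY.isClopen_top.preimage hf using 1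
    ext x
    exact (map_eq_top_iff f).symm
  isClopen_join U U' hU hU' := by
    obtain ⟨V, hV, hVU⟩ := exists_isClopen_preimage_eq f hf' hU
    obtain ⟨V', hV', hVU'⟩ := exists_isClopen_preimage_eq f hf' hU'
    rw [← hVU, ← hVU', filterJoin_preimage]
    exact (hY.isClopen_join V V' hV hV').preimage hf

theorem IsModalLSpace.of_orderIso (hS : IsModalLSpace S) (f : X ≃o Y) (hf : Continuous f)
    (hf' : Continuous f.symm) (h : ∀ x y, R x y ↔ S (f x) (f y)) : IsModalLSpace R where
  isLSpace := hS.isLSpace.of_orderIso f hf hf'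
  serial x := by simpa only [h, f.surjective.exists] using hS.serial (f x)
  top_iff x := by rw [h, f.map_top, hS.top_iff, map_eq_top_iff]
  box_clopen U hU := by
    obtain ⟨V, hV, hVU⟩ := exists_isClopen_preimage_eq f hf' hU
    rw [← hVU, boxR_preimage f.surjective h]
    exact ⟨isPFilter_preimage f (hS.box_clopen V hV).1, (hS.box_clopen V hV).2.preimage hf⟩
  dia_clopen U hU := by
    obtain ⟨V, hV, hVU⟩ := exists_isClopen_preimage_eq f hf' hU
    rw [← hVU, diaR_preimage f.surjective h]
    exact ⟨isPFilter_preimage f (hS.dia_clopen V hV).1, (hS.dia_clopen V hV).2.preimage hf⟩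
  rel_iff x y := by
    rw [h, hS.rel_iff]
    refine ⟨fun hxy U hU => ?_, fun hxy V hV => ?_⟩
    · obtain ⟨V, hV, hVU⟩ := exists_isClopen_preimage_eq f hf' hU
      rw [← SetLike.mem_coe, ← hVU, boxR_preimage f.surjective h, diaR_preimage f.surjective h]
      exact hxy V hV
    · have hxy' : (x ∈ boxR R (f ⁻¹' V) → f y ∈ V) ∧ (f y ∈ V → x ∈ diaR R (f ⁻¹' V)) :=
        hxy (isPFilter_preimage f V.isPFilter).toPFilter (hV.preimage hf)
      rwa [boxR_preimage f.surjective h, diaR_preimage f.surjective h] at hxy'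

theorem IsModalLSpace.iso_dualRel (hR : IsModalLSpace R) :
    ModalLSpaceIso R (dualRel hR.isGeneralLFrame.Algebra) := by
  let f : X ≃o PFilter hR.isGeneralLFrame.Algebra := pointFilterIso hR.isLSpace.toIsHMSSpace
  have hf : Continuous f := continuous_generateFrom_iff.2 <| by
    rintro s ⟨U, rfl | rfl⟩
    · exact U.2.2.isOpen
    · exact U.2.2.compl.isOpen
  have := hR.isLSpace.compact
  have := (isHMSSpace_pfilter (A := hR.isGeneralLFrame.Algebra)).priestleySpace
  refine modalLSpaceIso_iff_exists_orderIso.2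
    ⟨f, hf, hf.continuous_symm_of_equiv_compact_to_t2 (f := f.toEquiv), fun x y => ?_⟩
  rw [hR.rel_iff]
  exact ⟨fun h U => h U.2.1.toPFilter U.2.2, fun h U hU => h ⟨U, U.isPFilter, hU⟩⟩

end Isomorphisms

end WPML

theorem mainTheorem5 {P : Type u} (p : P) (Γ : Set AxiomName) :
    (∀ (X : Type w) [SemilatticeInf X] [OrderTop X] [TopologicalSpace X] (R : X → X → Prop),
      (IsModalLSpace R ∧ Theta Γ R) ↔
        ∃ (A : Type w) (_ : ModalLattice A),
          InVariety (axiomPairs p Γ) A ∧ ModalLSpaceIso R (dualRel A)) ∧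
    SoundAndComplete (axiomPairs p Γ) {F : ModalLFrame.{v} | Theta Γ F.rel} := by
  refine ⟨fun X _ _ _ R => ⟨fun ⟨hR, hΓ⟩ => ?_, fun ⟨A, _, hA, hiso⟩ => ?_⟩,
    soundAndComplete_theta p Γ⟩
  · exact ⟨hR.isGeneralLFrame.Algebra, inferInstance,
      hR.isGeneralLFrame.inVariety_algebra fun c hc => hΓ.forces hc, hR.iso_dualRel⟩
  · obtain ⟨f, hf, hf', h⟩ := modalLSpaceIso_iff_exists_orderIso.1 hiso
    exact ⟨(isModalLSpace_dualRel A).of_orderIso f hf hf' h,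
      (theta_dualRel hA).of_surjective f.surjective h⟩
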